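/- Let $n\in\{1,2,\dots\}$ or $n=\infty$, let $\mathbb F_n^+$ be the free semigroup with generators $g_1,\dots,g_n$ and neutral element $g_0$, and let $F^2(H_n)$ be the full Fock space of the $n$-dimensional complex Hilbert space $H_n$, with orthonormal basis $\{e_\alpha\}_{\alpha\in\mathbb F_n^+}$ and left creation operators $S_ie_\alpha=e_{g_i\alpha}$. For operators $T_1,\dots,T_n$ put $T_\alpha=T_{i_1}\cdots T_{i_k}$ if $\alpha=g_{i_1}\cdots g_{i_k}$, $T_{g_0}=I$, and $p(T_1,\dots,T_n)=\sum_\alpha a_\alpha T_\alpha$ for $p=\sum_\alpha a_\alpha\alpha\in\mathbb C\mathbb F_n^+$; $[T_1,\dots,T_n]$ is a row contraction if $\sum_iT_iT_i^*\le I$. Let $\mathcal P_h\subset\mathbb C\mathbb F_n^+$ be a set of homogeneous polynomials (all words occurring in $p$ have the same length). Let $F_n^\infty$ be the WOT-closed algebra generated by $S_1,\dots,S_n$ and $I$, let $J$ be the WOT-closed two-sided ideal of $F_n^\infty$ generated by $\{p(S_1,\dots,S_n):p\in\mathcal P_h\}$, let $\mathcal N_J=F^2(H_n)\ominus JF^2(H_n)$,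 and let $B_i=P_{\mathcal N_J}S_i|_{\mathcal N_J}$. Let $C^*(B_1,\dots,B_n)$, respectively $\mathcal A_n$, be the $C^*$-algebra, respectively the non-selfadjoint norm-closed algebra, generated by $B_1,\dots,B_n$ and the identity. Let $\mathcal H$ be a complex Hilbert space. A linear map $\mu:C^*(B_1,\dots,B_n)\to B(\mathcal H)$ is called a Poisson transform if it is unital, completely positive, and $\mu(AX)=\mu(A)\mu(X)$ for all $A\in\mathcal A_n$ and $X\in\mathcal A_n\mathcal A_n^*$. **Theorem.** (a) A linear map $\mu:C^*(B_1,\dots,B_n)\to B(\mathcal H)$ is a Poisson transform if and only if it is completely positive and there is a row contraction $[T_1,\dots,T_n]$, $T_i\in B(\mathcal H)$, with $p(T_1,\dots,T_n)=0$ for all $p\in\mathcal P_h$, such that $$\mu(B_\alpha B_\beta^*)=T_\alpha T_\beta^*,\qquad \alpha,\beta\in\mathbb F_n^+.\tag{$*$}$$ (b) For every row contraction $[T_1,\dots,T_n]$, $T_i\in B(\mathcal H)$, with $p(T_1,\dots,T_n)=0$ for all $p\in\mathcal P_h$, there is a Poisson transform $\mu:C^*(B_1,\dots,B_n)\to B(\mathcal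 H)$ that satisfies $(*)$. (c) If the linear span of $\{B_\alpha B_\beta^*:\alpha,\beta\in\mathbb F_n^+\}$ is norm dense in $C^*(B_1,\dots,B_n)$, then a bounded linear map $\mu:C^*(B_1,\dots,B_n)\to B(\mathcal H)$ is a Poisson transform if and only if there is a row contraction $[T_1,\dots,T_n]$, $T_i\in B(\mathcal H)$, with $p(T_1,\dots,T_n)=0$ for all $p\in\mathcal P_h$, such that $(*)$ holds. -/

import Mathlib

open scoped CStarAlgebra

noncomputable section

namespace Poisson

universe u v

/-! ### The free semigroup, its algebra, and operator tuples -/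

/-- The monomial `T_α = T_{i₁} T_{i₂} ⋯ T_{i_k}` for `α = g_{i₁} g_{i₂} ⋯ g_{i_k}`; the empty word
gives the identity. -/
def word {ι : Type u} {H : Type v} [NormedAddCommGroup H] [InnerProductSpace ℂ H]
    (T : ι → H →L[ℂ] H) (α : FreeMonoid ι) : H →L[ℂ] H :=
  FreeMonoid.lift T α

/-- The evaluation `p(T) = ∑ a_α T_α` of `p = ∑ a_α α` in the free semigroup algebra. -/
def evalPoly {ι : Type u} {H : Type v} [NormedAddCommGroup H] [InnerProductSpace ℂ H]
    (T : ι → H →L[ℂ] H) (p : MonoidAlgebra ℂ (FreeMonoid ι)) : H →L[ℂ] H :=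
  p.coeff.sum fun α a => a • word T α

/-- All words that occur in `p` with a nonzero coefficient have the same length. -/
def IsHomogeneous {ι : Type u} (p : MonoidAlgebra ℂ (FreeMonoid ι)) : Prop :=
  ∃ d : ℕ, ∀ α ∈ p.coeff.support, α.length = d

/-- Row contractions: `∑ i, T i (T i)^* ≤ 1`. For an infinite index set the sum of these positive
operators is the strong limit (and the supremum) of the increasing net of its finite partial sums,
so that the inequality says that all the finite partial sums are at most `1`; for a finite index set
the full sum is the largest of the partial sums. -/
def IsRowContraction {ι : Type u} {H : Type v} [NormedAddCommGroup H] [InnerProductSpace ℂ H]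
    [CompleteSpace H] (T : ι → H →L[ℂ] H) : Prop :=
  ∀ s : Finset ι, ∑ i ∈ s, T i * star (T i) ≤ 1

/-! ### The full Fock space and the left creation operators -/

/-- The full Fock space, as the Hilbert space with orthonormal basis `(e_α)` indexed by the free
semigroup, where `e_α = e_{i₁} ⊗ ⋯ ⊗ e_{i_k}` for `α = g_{i₁} ⋯ g_{i_k}`. -/
abbrev Fock (ι : Type u) : Type u := lp (fun _ : FreeMonoid ι => ℂ) 2

/-- The basis vector `e_α`. -/
def basisVec {ι : Type u} (α : FreeMonoid ι) : Fock ι :=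
  open Classical in lp.single 2 α (1 : ℂ)

theorem orthonormal_basisVec (ι : Type u) :
    Orthonormal ℂ (fun α : FreeMonoid ι => basisVec α) := by
  classical
  rw [orthonormal_iff_ite]
  intro α β
  simp only [basisVec, lp.inner_single_left, lp.single_apply]
  by_cases h : α = β
  · subst h
    simp
  · simp [h]

theorem orthonormal_shift {ι : Type u} (i : ι) :
    Orthonormal ℂ (fun α : FreeMonoid ι => basisVec (FreeMonoid.of i * α)) :=
  (orthonormal_basisVec ι).comp _ fun _ _ h => mul_left_cancel h

/-- The left creation operator `S_i ψ = e_i ⊗ ψ`, that is, the isometry with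
`S_i e_α = e_{g_i α}`. -/
def creation {ι : Type u} (i : ι) : Fock ι →L[ℂ] Fock ι :=
  (orthonormal_shift i).orthogonalFamily.linearIsometry.toContinuousLinearMap

theorem creation_basisVec {ι : Type u} (i : ι) (α : FreeMonoid ι) :
    creation i (basisVec α) = basisVec (FreeMonoid.of i * α) := by
  classical
  have h := (orthonormal_shift i).orthogonalFamily.linearIsometry_apply_single (i := α) (1 : ℂ)
  simp only [LinearIsometry.toSpanSingleton_apply, one_smul] at h
  rw [← h]
  simp only [creation, basisVec, LinearIsometry.coe_toContinuousLinearMap]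

/-! ### The noncommutative analytic Toeplitz algebra and the ideal of the relations -/

/-- A set of operators is closed in the weak operator topology. -/
def WOTClosed {E : Type v} [NormedAddCommGroup E] [InnerProductSpace ℂ E]
    (X : Set (E →L[ℂ] E)) : Prop :=
  IsClosed (ContinuousLinearMapWOT.toCLM ⁻¹' X : Set (E →WOT[ℂ] E))

/-- The noncommutative analytic Toeplitz algebra: the smallest WOT-closed algebra that contains the
left creation operators and the identity. -/
def toeplitzAlgebra (ι : Type u) : Subalgebra ℂ (Fock ι →L[ℂ] Fock ι) :=
  sInf {A | (∀ i, creation i ∈ A) ∧ WOTClosed (A : Set (Fock ι →L[ℂ] Fock ι))}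

/-- `I` is a WOT-closed two-sided ideal of the noncommutative analytic Toeplitz algebra. -/
structure IsWOTClosedIdeal {ι : Type u} (I : Submodule ℂ (Fock ι →L[ℂ] Fock ι)) : Prop where
  subset : ∀ x ∈ I, x ∈ toeplitzAlgebra ι
  mul_mem_left : ∀ f ∈ toeplitzAlgebra ι, ∀ x ∈ I, f * x ∈ I
  mul_mem_right : ∀ f ∈ toeplitzAlgebra ι, ∀ x ∈ I, x * f ∈ I
  closed : WOTClosed (I : Set (Fock ι →L[ℂ] Fock ι))

/-- The WOT-closed two-sided ideal `J` generated by the operators `p(S)`, `p ∈ P`. -/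
def relationIdeal {ι : Type u} (P : Set (MonoidAlgebra ℂ (FreeMonoid ι))) :
    Submodule ℂ (Fock ι →L[ℂ] Fock ι) :=
  sInf {I | IsWOTClosedIdeal I ∧ ∀ p ∈ P, evalPoly creation p ∈ I}

/-- The space `N_J`, the orthogonal complement of `J F²` in the full Fock space `F²`. -/
def quotientSpace {ι : Type u} (P : Set (MonoidAlgebra ℂ (FreeMonoid ι))) :
    Submodule ℂ (Fock ι) :=
  (Submodule.span ℂ {ψ : Fock ι | ∃ f ∈ relationIdeal P, ∃ ξ : Fock ι, ψ = f ξ})ᗮ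

instance {ι : Type u} (P : Set (MonoidAlgebra ℂ (FreeMonoid ι))) :
    CompleteSpace (quotientSpace P) :=
  Submodule.instOrthogonalCompleteSpace _

/-- The compression `B_i` of `S_i` to `N_J`. -/
def compression {ι : Type u} (P : Set (MonoidAlgebra ℂ (FreeMonoid ι))) (i : ι) :
    quotientSpace P →L[ℂ] quotientSpace P :=
  (quotientSpace P).orthogonalProjectionOnto ∘L creation i ∘L (quotientSpace P).subtypeL

/-! ### Generated operator algebras, completely positive maps, and Poisson transforms -/

section Generated

variable {ι : Type u} {E : Type v} [NormedAddCommGroup E] [InnerProductSpace ℂ E] [CompleteSpace E]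

/-- The C*-algebra generated by the operators `B i` and the identity. -/
def cstarGenerated (B : ι → E →L[ℂ] E) : StarSubalgebra ℂ (E →L[ℂ] E) :=
  (StarAlgebra.adjoin ℂ (Set.range B)).topologicalClosure

/-- The non-selfadjoint norm-closed algebra generated by the operators `B i` and the identity. -/
def discAlgebra (B : ι → E →L[ℂ] E) : Subalgebra ℂ (E →L[ℂ] E) :=
  (Algebra.adjoin ℂ (Set.range B)).topologicalClosure

instance (B : ι → E →L[ℂ] E) : IsClosed (cstarGenerated B : Set (E →L[ℂ] E)) :=
  StarSubalgebra.isClosed_topologicalClosure _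

instance : CStarAlgebra (E →L[ℂ] E) where

theorem self_mem_cstarGenerated (B : ι → E →L[ℂ] E) (i : ι) : B i ∈ cstarGenerated B :=
  StarSubalgebra.le_topologicalClosure _ (StarAlgebra.subset_adjoin ℂ _ ⟨i, rfl⟩)

theorem word_mem_cstarGenerated (B : ι → E →L[ℂ] E) (α : FreeMonoid ι) :
    word B α ∈ cstarGenerated B := by
  induction α using FreeMonoid.inductionOn' with
  | one => simp [word]
  | of_mul i α ih =>
    have h := mul_mem (self_mem_cstarGenerated B i) ih
    simpa [word] using h

/-- The monomial `B_α` as an element of the C*-algebra generated by the `B i`. -/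
def gword (B : ι → E →L[ℂ] E) (α : FreeMonoid ι) : cstarGenerated B :=
  ⟨word B α, word_mem_cstarGenerated B α⟩

end Generated

/-- A linear map of C*-algebras is completely positive for the canonical orders
(in which the positive elements are the selfadjoint ones with nonnegative spectrum). -/
def IsCompletelyPositive {A : Type u} {A' : Type v} [CStarAlgebra A] [CStarAlgebra A']
    (φ : A →ₗ[ℂ] A') : Prop :=
  letI : PartialOrder A := CStarAlgebra.spectralOrder A
  letI : StarOrderedRing A := CStarAlgebra.spectralOrderedRing A
  letI : PartialOrder A' := CStarAlgebra.spectralOrder A'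
  letI : StarOrderedRing A' := CStarAlgebra.spectralOrderedRing A'
  ∃ Φ : A →CP A', Φ.toLinearMap = φ

/-- A linear map `μ` from the C*-algebra generated by the `B i` to the bounded operators on `H` is a
Poisson transform if it is unital, completely positive, and `μ (A X) = μ A μ X` for `A` in the
norm-closed algebra `𝒜` generated by the `B i` and the identity and `X = C D^*` with `C, D ∈ 𝒜`. -/
structure IsPoissonTransform {ι : Type*} {E H : Type*} [NormedAddCommGroup E]
    [InnerProductSpace ℂ E] [CompleteSpace E] [NormedAddCommGroup H] [InnerProductSpace ℂ H]
    [CompleteSpace H] (B : ι → E →L[ℂ] E) (μ : cstarGenerated B →ₗ[ℂ] (H →L[ℂ] H)) : Prop where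
  map_one : μ 1 = 1
  completelyPositive : IsCompletelyPositive μ
  map_mul : ∀ A C D : cstarGenerated B, (A : E →L[ℂ] E) ∈ discAlgebra B →
    (C : E →L[ℂ] E) ∈ discAlgebra B → (D : E →L[ℂ] E) ∈ discAlgebra B →
    μ (A * (C * star D)) = μ A * μ (C * star D)

/-- The formula `μ (B_α B_β^*) = T_α T_β^*` for all words `α, β`. -/
def Represents {ι : Type*} {E H : Type*} [NormedAddCommGroup E]
    [InnerProductSpace ℂ E] [CompleteSpace E] [NormedAddCommGroup H] [InnerProductSpace ℂ H]
    [CompleteSpace H] (B : ι → E →L[ℂ] E) (T : ι → H →L[ℂ] H)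
    (μ : cstarGenerated B →ₗ[ℂ] (H →L[ℂ] H)) : Prop :=
  ∀ α β : FreeMonoid ι, μ (gword B α * star (gword B β)) = word T α * star (word T β)

end Poisson

end

/-! The substance is existence. Let `R` be a row contraction satisfying the relations, with `∑ R_i
R_i^* ≤ r < 1`, and let `D^* D = 1 - ∑ R_i R_i^*`. The Poisson kernel `K h = ∑_α e_α ⊗ D R_α^* h` is
an isometry of `H` into `F² ⊗ H`: the squared norms telescope over word length, and the remainder
dies geometrically (`hasSum_defect_word`). It satisfies `(S_i^* ⊗ 1) K = K R_i^*`. Hence `K^* (p(S)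
⊗ 1) = p(R) K^* = 0` for every relation `p`, which forces the range of `K` into `N_J ⊗ H`
(`mem_quotientSpace_of_intertwining`). As `B_i^*` is the restriction of `S_i^*` to `N_J`, the map `X
↦ K^* (X ⊗ 1) K` is completely positive and sends `B_α B_β^*` to `R_α R_β^*`.

A general `T` is approximated by `rT` with `r → 1`; homogeneity preserves the relations. The maps
for `rT` are contractive, so they have a point-weak limit along an ultrafilter
(`exists_ultrafilter_limit`). Tensor products are avoided by working with the components `K_j` of
`K` along an orthonormal basis of `H`. Complete positivity is carried through sums and limits as
positive definiteness of `(a, b) ↦ φ (a^* b)`, a family of scalar inequalities.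

Conversely, a Poisson transform yields `T_i = μ(B_i)`: multiplicativity gives `(*)`, linearity gives
the relations, and positivity of `1 - ∑ B_i B_i^*` gives the row contraction. A completely positive
map with `(*)` is multiplicative on words, hence by continuity on the norm-closed algebra. Under the
density hypothesis `(*)` determines a bounded map, which is therefore the one constructed. -/

noncomputable section

namespace Poisson

open Filter Topology ContinuousLinearMap

/-! ### Positive matrices of operators -/

section MatrixAction

variable {H : Type*} [NormedAddCommGroup H] [InnerProductSpace ℂ H] [CompleteSpace H] {k : ℕ}

/-- The action of a square matrix of operators on column vectors. -/
def matAct (M : CStarMatrix (Fin k) (Fin k) (H →L[ℂ] H)) (h : Fin k → H) : Fin k → H :=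
  fun i => ∑ j, M i j (h j)

omit [CompleteSpace H] in
theorem matAct_mul (M N : CStarMatrix (Fin k) (Fin k) (H →L[ℂ] H)) (h : Fin k → H) :
    matAct (M * N) h = matAct M (matAct N h) := by
  funext i
  simp only [matAct, CStarMatrix.mul_apply, sum_apply, map_sum]
  exact Finset.sum_comm

omit [CompleteSpace H] in
theorem matAct_neg (M : CStarMatrix (Fin k) (Fin k) (H →L[ℂ] H)) (h : Fin k → H) :
    matAct (-M) h = -matAct M h := by
  funext i
  simp [matAct]

theorem sum_inner_matAct_star (M : CStarMatrix (Fin k) (Fin k) (H →L[ℂ] H)) (g h : Fin k → H) :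
    ∑ i, inner ℂ (g i) (matAct (star M) h i) = ∑ i, inner ℂ (matAct M g i) (h i) := by
  simp only [matAct, CStarMatrix.star_apply, inner_sum, sum_inner, star_eq_adjoint,
    adjoint_inner_right]
  exact Finset.sum_comm

omit [CompleteSpace H] in
theorem eq_zero_of_matAct_eq_zero {M : CStarMatrix (Fin k) (Fin k) (H →L[ℂ] H)}
    (h : ∀ v, matAct M v = 0) : M = 0 := by
  ext i j x
  have := congrFun (h (Pi.single j x)) i
  simp only [matAct] at this
  rw [Finset.sum_eq_single j] at this
  · simpa using this
  · intro b _ hb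
    simp [Pi.single_eq_of_ne hb]
  · simp

theorem re_sum_inner_matAct_star_mul_self (M : CStarMatrix (Fin k) (Fin k) (H →L[ℂ] H))
    (h : Fin k → H) :
    (∑ i, inner ℂ (h i) (matAct (star M * M) h i)).re = ∑ i, ‖matAct M h i‖ ^ 2 := by
  rw [matAct_mul, sum_inner_matAct_star, Complex.re_sum]
  exact Finset.sum_congr rfl fun i _ => inner_self_eq_norm_sq (𝕜 := ℂ) _

theorem _root_.CStarAlgebra.exists_eq_sub_of_isSelfAdjoint {D : Type*} [CStarAlgebra D]
    [PartialOrder D] [StarOrderedRing D] {a : D} (ha : IsSelfAdjoint a) :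
    ∃ p q : D, 0 ≤ p ∧ 0 ≤ q ∧ q * p = 0 ∧ a = p - q :=
  ⟨a⁺, a⁻, CFC.posPart_nonneg a, CFC.negPart_nonneg a, CFC.negPart_mul_posPart a,
    (CFC.posPart_sub_negPart a ha).symm⟩

theorem _root_.CStarAlgebra.exists_eq_star_mul_self_of_nonneg {D : Type*} [CStarAlgebra D]
    [PartialOrder D] [StarOrderedRing D] {a : D} (ha : 0 ≤ a) : ∃ b, a = star b * b :=
  CStarAlgebra.nonneg_iff_eq_star_mul_self.mp ha

/-- Write `M = p - q` with `p, q ≥ 0` and `q p = 0`, so `q M q = -q³`. The form of `M` at `q v` is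
nonnegative, while `q³ = (Q q)^* (Q q)` for `q = Q^* Q`; so `Q q = 0`, whence `q³ = 0` and `q = 0`.
-/
theorem cstarMatrix_nonneg_of_re_inner_nonneg [PartialOrder (H →L[ℂ] H)]
    [StarOrderedRing (H →L[ℂ] H)] (M : CStarMatrix (Fin k) (Fin k) (H →L[ℂ] H))
    (hM : IsSelfAdjoint M) (hpos : ∀ h : Fin k → H, 0 ≤ (∑ i, inner ℂ (h i) (matAct M h i)).re) :
    0 ≤ M := by
  obtain ⟨p, q, hp, hq, hqp, hdec⟩ := CStarAlgebra.exists_eq_sub_of_isSelfAdjoint hM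
  have hqs : star q = q := (IsSelfAdjoint.of_nonneg hq).star_eq
  have hqM : q * M * q = -(q * q * q) := by
    rw [hdec, mul_sub, hqp, zero_sub, neg_mul]
  obtain ⟨Q, hQ⟩ := CStarAlgebra.exists_eq_star_mul_self_of_nonneg hq
  have hcube : q * q * q = star (Q * q) * (Q * q) := by
    rw [star_mul, hqs]
    nth_rewrite 2 [hQ]
    simp only [mul_assoc]
  have hzero : Q * q = 0 := by
    apply eq_zero_of_matAct_eq_zero
    intro v
    have h1 := re_sum_inner_matAct_star_mul_self (Q * q) v
    have h2 := hpos (matAct q v)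
    rw [← sum_inner_matAct_star, hqs, ← matAct_mul, ← matAct_mul, hqM, hcube] at h2
    have h3 : (∑ i, inner ℂ (v i) (matAct (-(star (Q * q) * (Q * q))) v i)).re =
        -(∑ i, inner ℂ (v i) (matAct (star (Q * q) * (Q * q)) v i)).re := by
      simp only [matAct_neg, Pi.neg_apply, inner_neg_right, Finset.sum_neg_distrib, Complex.neg_re]
    rw [h3, h1] at h2
    have h4 : ∑ i, ‖matAct (Q * q) v i‖ ^ 2 = 0 :=
      le_antisymm (by linarith) (Finset.sum_nonneg fun _ _ => by positivity)
    funext i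
    have := (Finset.sum_eq_zero_iff_of_nonneg fun _ _ => by positivity).mp h4 i (Finset.mem_univ i)
    simpa using this
  rw [hzero, mul_zero] at hcube
  have hsq : q * q = 0 := by
    rw [← CStarRing.star_mul_self_eq_zero_iff, star_mul, hqs, ← mul_assoc, hcube, zero_mul]
  have h0 : q = 0 := by
    rw [← CStarRing.star_mul_self_eq_zero_iff, hqs, hsq]
  rw [hdec, h0, sub_zero]
  exact hp

end MatrixAction

/-! ### Contractive completely positive maps given by positive definite kernels -/

section Kernels

variable {A : Type*} [CStarAlgebra A]
  {H : Type*} [NormedAddCommGroup H] [InnerProductSpace ℂ H] [CompleteSpace H]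

/-- A contractive self-adjoint linear map `φ` for which `(a, b) ↦ φ (a^* b)` is a positive definite
operator-valued kernel. -/
structure IsPositiveDefinite (φ : A →ₗ[ℂ] (H →L[ℂ] H)) : Prop where
  map_star : ∀ a, φ (star a) = star (φ a)
  re_inner_nonneg : ∀ (k : ℕ) (a : Fin k → A) (h : Fin k → H),
    0 ≤ (∑ i, ∑ j, inner ℂ (h i) (φ (star (a i) * a j) (h j))).re
  norm_le : ∀ a, ‖φ a‖ ≤ ‖a‖

/-- A positive matrix is `N^* N`, and the form of its image under `φ` splits into one kernel sum for
each row of `N`. -/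
theorem IsPositiveDefinite.isCompletelyPositive {φ : A →ₗ[ℂ] (H →L[ℂ] H)}
    (hφ : IsPositiveDefinite φ) : IsCompletelyPositive φ := by
  unfold IsCompletelyPositive
  let : PartialOrder A := CStarAlgebra.spectralOrder A
  let : StarOrderedRing A := CStarAlgebra.spectralOrderedRing A
  let : PartialOrder (H →L[ℂ] H) := CStarAlgebra.spectralOrder (H →L[ℂ] H)
  let : StarOrderedRing (H →L[ℂ] H) := CStarAlgebra.spectralOrderedRing (H →L[ℂ] H)
  refine ⟨⟨φ, fun k M hM => ?_⟩, rfl⟩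
  obtain ⟨N, hN⟩ := CStarAlgebra.exists_eq_star_mul_self_of_nonneg hM
  refine cstarMatrix_nonneg_of_re_inner_nonneg _ ?_ fun h => ?_
  · have hMs := IsSelfAdjoint.of_nonneg hM
    ext1 i j
    have hij := congrFun (congrFun hMs.star_eq i) j
    rw [CStarMatrix.star_apply] at hij
    rw [CStarMatrix.star_apply, CStarMatrix.map_apply, CStarMatrix.map_apply]
    exact (hφ.map_star _).symm.trans (congrArg φ hij)
  · have : ∑ i, inner ℂ (h i) (matAct (M.map φ) h i) =
        ∑ l, ∑ i, ∑ j, inner ℂ (h i) (φ (star (N l i) * N l j) (h j)) := by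
      simp only [matAct, CStarMatrix.map_apply, hN, CStarMatrix.mul_apply, CStarMatrix.star_apply,
        map_sum, sum_apply, inner_sum]
      exact (Finset.sum_congr rfl fun i _ => Finset.sum_comm).trans Finset.sum_comm
    refine le_of_le_of_eq ?_ (congrArg Complex.re this.symm)
    rw [Complex.re_sum]
    exact Finset.sum_nonneg fun l _ => hφ.re_inner_nonneg k (N l) h

/-- Contractivity confines each matrix coefficient to a fixed disc, so it converges along `l`. The
limits form bounded sesquilinear forms, and all conditions of positive definiteness are closed under
such limits. -/
theorem exists_ultrafilter_limit {κ : Type*} (l : Ultrafilter κ) (φ : κ → A →ₗ[ℂ] (H →L[ℂ] H))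
    (hφ : ∀ i, IsPositiveDefinite (φ i)) :
    ∃ ψ : A →ₗ[ℂ] (H →L[ℂ] H), IsPositiveDefinite ψ ∧
      ∀ a g h, Tendsto (fun i => inner ℂ g (φ i a h)) l (𝓝 (inner ℂ g (ψ a h))) := by
  have bound : ∀ i a g h, ‖inner ℂ (φ i a h) g‖ ≤ ‖a‖ * ‖h‖ * ‖g‖ := fun i a g h =>
    (norm_inner_le_norm _ _).trans (by
      gcongr
      exact ((φ i a).le_opNorm h).trans (by gcongr; exact (hφ i).norm_le a))
  have hlim : ∀ a h g, ∃ z : ℂ, Tendsto (fun i => inner ℂ (φ i a h) g) l (𝓝 z) := fun a h g => by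
    obtain ⟨z, -, hz⟩ := (isCompact_closedBall (0 : ℂ) (‖a‖ * ‖h‖ * ‖g‖)).ultrafilter_le_nhds
      (l.map fun i => inner ℂ (φ i a h) g)
      (tendsto_principal.mpr (Eventually.of_forall fun i => by simpa using bound i a g h))
    exact ⟨z, hz⟩
  choose F hF using hlim
  have hFb : ∀ a h g, ‖F a h g‖ ≤ ‖a‖ * ‖h‖ * ‖g‖ := fun a h g =>
    le_of_tendsto (hF a h g).norm (Eventually.of_forall fun i => bound i a g h)
  let B : A → H →ₗ⋆[ℂ] H →ₗ[ℂ] ℂ := fun a => LinearMap.mk₂'ₛₗ (starRingEnd ℂ) (RingHom.id ℂ) (F a)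
    (fun x y g => tendsto_nhds_unique (hF a (x + y) g) (by
      simpa only [map_add, inner_add_left] using (hF a x g).add (hF a y g)))
    (fun c x g => tendsto_nhds_unique (hF a (c • x) g) (by
      simpa only [map_smul, inner_smul_left, smul_eq_mul] using
        (hF a x g).const_mul ((starRingEnd ℂ) c)))
    (fun x g g' => tendsto_nhds_unique (hF a x (g + g')) (by
      simpa only [inner_add_right] using (hF a x g).add (hF a x g')))
    (fun c x g => tendsto_nhds_unique (hF a x (c • g)) (by
      simpa only [inner_smul_right, smul_eq_mul, RingHom.id_apply] using (hF a x g).const_mul _))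
  let Ψ : A → H →L[ℂ] H := fun a => InnerProductSpace.continuousLinearMapOfBilin
    ((B a).mkContinuous₂ ‖a‖ (hFb a))
  have hΨ : ∀ a h g, inner ℂ (Ψ a h) g = F a h g := fun a h g =>
    InnerProductSpace.continuousLinearMapOfBilin_apply _ h g
  have hadd : ∀ a b, Ψ (a + b) = Ψ a + Ψ b := fun a b => by
    ext h
    refine ext_inner_right ℂ fun g => ?_
    rw [add_apply, inner_add_left, hΨ, hΨ, hΨ]
    refine tendsto_nhds_unique (hF (a + b) h g) ?_
    simpa only [map_add, add_apply, inner_add_left] using (hF a h g).add (hF b h g)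
  have hsmul : ∀ (c : ℂ) a, Ψ (c • a) = c • Ψ a := fun c a => by
    ext h
    refine ext_inner_right ℂ fun g => ?_
    rw [smul_apply, inner_smul_left, hΨ, hΨ]
    refine tendsto_nhds_unique (hF (c • a) h g) ?_
    simpa only [map_smul, smul_apply, inner_smul_left] using (hF a h g).const_mul _
  let ψ : A →ₗ[ℂ] (H →L[ℂ] H) := ⟨⟨Ψ, hadd⟩, hsmul⟩
  have hψ : ∀ a g h, Tendsto (fun i => inner ℂ g (φ i a h)) l (𝓝 (inner ℂ g (ψ a h))) := by
    intro a g h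
    have := (Complex.continuous_conj.tendsto _).comp (hF a h g)
    rw [← hΨ, inner_conj_symm] at this
    refine this.congr fun i => ?_
    simp [inner_conj_symm]
  refine ⟨ψ, ⟨fun a => ?_, fun k a h => ?_, fun a => ?_⟩, hψ⟩
  · ext h
    refine ext_inner_left ℂ fun g => ?_
    rw [star_eq_adjoint, adjoint_inner_right]
    refine tendsto_nhds_unique (hψ (star a) g h) ?_
    have : inner ℂ (ψ a g) h = F a g h := hΨ a g h
    rw [this]
    refine (hF a g h).congr fun i => ?_
    rw [(hφ i).map_star, star_eq_adjoint, adjoint_inner_right]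
  · have ht : Tendsto (fun n => (∑ i, ∑ j, inner ℂ (h i) (φ n (star (a i) * a j) (h j))).re) l
        (𝓝 (∑ i, ∑ j, inner ℂ (h i) (ψ (star (a i) * a j) (h j))).re) :=
      (Complex.continuous_re.tendsto _).comp
        (tendsto_finsetSum _ fun i _ => tendsto_finsetSum _ fun j _ => hψ _ _ _)
    exact ge_of_tendsto' ht fun n => (hφ n).re_inner_nonneg k a h
  · refine opNorm_le_bound _ (norm_nonneg _) fun h => ?_
    by_cases h0 : ψ a h = 0
    · rw [h0, norm_zero]; positivity
    · have h1 : ‖inner ℂ (ψ a h) (ψ a h)‖ ≤ ‖a‖ * ‖h‖ * ‖ψ a h‖ := by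
        have : inner ℂ (ψ a h) (ψ a h) = F a h (ψ a h) := hΨ a h _
        rw [this]
        exact hFb _ _ _
      rw [inner_self_eq_norm_sq_to_K] at h1
      have h2 : 0 < ‖ψ a h‖ := norm_pos_iff.mpr h0
      simp only [Complex.coe_algebraMap, norm_pow, Complex.norm_real, norm_norm] at h1
      nlinarith

/-- Finite sums of compressions of concretely represented algebras are positive definite. -/
theorem exists_sum_compression {E : Type*} [NormedAddCommGroup E] [InnerProductSpace ℂ E]
    [CompleteSpace E] (π : A →⋆ₐ[ℂ] (E →L[ℂ] E)) {κ : Type*} (s : Finset κ) (K : κ → H →L[ℂ] E)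
    (hK : ∀ h, ∑ j ∈ s, ‖K j h‖ ^ 2 ≤ ‖h‖ ^ 2) :
    ∃ φ : A →ₗ[ℂ] (H →L[ℂ] H), IsPositiveDefinite φ ∧
      ∀ a g h, inner ℂ g (φ a h) = ∑ j ∈ s, inner ℂ (K j g) (π a (K j h)) := by
  let φ : A →ₗ[ℂ] (H →L[ℂ] H) :=
    { toFun := fun a => ∑ j ∈ s, adjoint (K j) ∘L π a ∘L K j
      map_add' := fun a b => by
        simp only [map_add, add_comp, comp_add, Finset.sum_add_distrib]
      map_smul' := fun c a => by
        simp only [map_smul, smul_comp, comp_smul, Finset.smul_sum, RingHom.id_apply] }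
  have hφ : ∀ a g h, inner ℂ g (φ a h) = ∑ j ∈ s, inner ℂ (K j g) (π a (K j h)) := by
    intro a g h
    simp [φ, sum_apply, adjoint_inner_right]
  refine ⟨φ, ⟨fun a => ?_, fun k a h => ?_, fun a => ?_⟩, hφ⟩
  · ext h
    refine ext_inner_left ℂ fun g => ?_
    rw [hφ, star_eq_adjoint, adjoint_inner_right, ← inner_conj_symm, hφ, map_sum]
    refine Finset.sum_congr rfl fun j _ => ?_
    rw [map_star, star_eq_adjoint, adjoint_inner_right, inner_conj_symm]
  · have : ∑ i, ∑ j, inner ℂ (h i) (φ (star (a i) * a j) (h j)) =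
        ∑ l ∈ s, inner ℂ (∑ i, π (a i) (K l (h i))) (∑ i, π (a i) (K l (h i))) := by
      simp only [hφ, inner_sum, sum_inner, map_mul, map_star, mul_def, comp_apply, star_eq_adjoint,
        adjoint_inner_right]
      rw [Finset.sum_comm]
      simp_rw [Finset.sum_comm (t := s)]
    rw [this, Complex.re_sum]
    exact Finset.sum_nonneg fun l _ => inner_self_nonneg (𝕜 := ℂ)
  · refine opNorm_le_bound _ (norm_nonneg _) fun h => ?_
    by_cases h0 : φ a h = 0
    · rw [h0, norm_zero]; positivity
    have h2 : 0 < ‖φ a h‖ := norm_pos_iff.mpr h0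
    -- Cauchy–Schwarz over `j`, tested against the vector `φ a h` itself; one factor of its norm
    -- then cancels.
    have h1 : ‖φ a h‖ ^ 2 ≤ ‖a‖ * (‖φ a h‖ * ‖h‖) := by
      calc ‖φ a h‖ ^ 2 = ‖inner ℂ (φ a h) (φ a h)‖ := by
            rw [inner_self_eq_norm_sq_to_K]; simp
        _ = ‖∑ j ∈ s, inner ℂ (K j (φ a h)) (π a (K j h))‖ := by rw [hφ]
        _ ≤ ∑ j ∈ s, ‖a‖ * (‖K j (φ a h)‖ * ‖K j h‖) := by
            refine norm_sum_le_of_le _ fun j _ => (norm_inner_le_norm _ _).trans ?_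
            calc ‖K j (φ a h)‖ * ‖π a (K j h)‖ ≤ ‖K j (φ a h)‖ * (‖a‖ * ‖K j h‖) := by
                  gcongr
                  exact ((π a).le_opNorm _).trans (by
                    gcongr
                    exact NonUnitalStarAlgHom.norm_apply_le π a)
              _ = _ := by ring
        _ = ‖a‖ * ∑ j ∈ s, ‖K j (φ a h)‖ * ‖K j h‖ := by rw [Finset.mul_sum]
        _ ≤ ‖a‖ * (‖φ a h‖ * ‖h‖) := by
            gcongr
            refine (Real.sum_mul_le_sqrt_mul_sqrt _ _ _).trans ?_
            gcongr
            · exact Real.sqrt_le_iff.mpr ⟨norm_nonneg _, hK _⟩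
            · exact Real.sqrt_le_iff.mpr ⟨norm_nonneg _, hK _⟩
    nlinarith

theorem IsCompletelyPositive.map_star {A' : Type*} [CStarAlgebra A'] {φ : A →ₗ[ℂ] A'}
    (hφ : IsCompletelyPositive φ) (a : A) : φ (star a) = star (φ a) := by
  unfold IsCompletelyPositive at hφ
  let : PartialOrder A := CStarAlgebra.spectralOrder A
  let : StarOrderedRing A := CStarAlgebra.spectralOrderedRing A
  let : PartialOrder A' := CStarAlgebra.spectralOrder A'
  let : StarOrderedRing A' := CStarAlgebra.spectralOrderedRing A'
  obtain ⟨Φ, rfl⟩ := hφ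
  exact StarHomClass.map_star (PositiveLinearMap.ofClass Φ) a

theorem IsCompletelyPositive.continuous {A' : Type*} [CStarAlgebra A'] {φ : A →ₗ[ℂ] A'}
    (hφ : IsCompletelyPositive φ) : Continuous φ := by
  unfold IsCompletelyPositive at hφ
  let : PartialOrder A := CStarAlgebra.spectralOrder A
  let : StarOrderedRing A := CStarAlgebra.spectralOrderedRing A
  let : PartialOrder A' := CStarAlgebra.spectralOrder A'
  let : StarOrderedRing A' := CStarAlgebra.spectralOrderedRing A'
  obtain ⟨Φ, rfl⟩ := hφ
  exact map_continuous Φ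

/-- Positivity of `φ (1 - ∑ x_i x_i^*)`, phrased as a factorization because the orders on the two
algebras are local to the proof. -/
theorem IsCompletelyPositive.exists_map_one_sub_eq {A' : Type*} [CStarAlgebra A']
    {φ : A →ₗ[ℂ] A'} (hφ : IsCompletelyPositive φ) {κ : Type*} (s : Finset κ) (x : κ → A)
    (hx : ‖∑ i ∈ s, x i * star (x i)‖ ≤ 1) :
    ∃ b, φ 1 - ∑ i ∈ s, φ (x i * star (x i)) = star b * b := by
  unfold IsCompletelyPositive at hφ
  let : PartialOrder A := CStarAlgebra.spectralOrder A
  let : StarOrderedRing A := CStarAlgebra.spectralOrderedRing A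
  let : PartialOrder A' := CStarAlgebra.spectralOrder A'
  let : StarOrderedRing A' := CStarAlgebra.spectralOrderedRing A'
  obtain ⟨Φ, rfl⟩ := hφ
  have h0 : 0 ≤ ∑ i ∈ s, x i * star (x i) := Finset.sum_nonneg fun i _ => mul_star_self_nonneg _
  have h1 := sub_nonneg.mpr ((CStarAlgebra.norm_le_one_iff_of_nonneg _ h0).mp hx)
  have h2 : (0 : A') ≤ Φ (1 - ∑ i ∈ s, x i * star (x i)) := map_nonneg Φ h1
  rw [map_sub, map_sum] at h2
  exact CStarAlgebra.exists_eq_star_mul_self_of_nonneg h2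

end Kernels

/-! ### Sums over words of strict row contractions -/

section Words

variable {ι : Type*} {H : Type*} [NormedAddCommGroup H] [InnerProductSpace ℂ H]

@[simp] theorem word_one (T : ι → H →L[ℂ] H) : word T 1 = 1 := map_one _

theorem word_mul (T : ι → H →L[ℂ] H) (α β : FreeMonoid ι) :
    word T (α * β) = word T α * word T β := map_mul _ _ _

@[simp] theorem word_of (T : ι → H →L[ℂ] H) (i : ι) : word T (FreeMonoid.of i) = T i :=
  FreeMonoid.lift_eval_of _ _

theorem word_smul (c : ℂ) (T : ι → H →L[ℂ] H) (α : FreeMonoid ι) :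
    word (fun i => c • T i) α = c ^ α.length • word T α := by
  induction α using FreeMonoid.inductionOn' with
  | one => simp
  | of_mul i α ih =>
    rw [word_mul, word_mul, ih, word_of, word_of, FreeMonoid.length_mul, FreeMonoid.length_of,
      pow_add, pow_one, smul_mul_smul_comm]

/-- For `p` of degree `d` one has `p(cT) = c^d p(T)`. This is where homogeneity enters: the
relations survive passage to `rT`. -/
theorem evalPoly_smul_eq_zero {c : ℂ} {T : ι → H →L[ℂ] H} {p : MonoidAlgebra ℂ (FreeMonoid ι)}
    (hp : IsHomogeneous p) (h : evalPoly T p = 0) : evalPoly (fun i => c • T i) p = 0 := by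
  obtain ⟨d, hd⟩ := hp
  have : evalPoly (fun i => c • T i) p = c ^ d • evalPoly T p := by
    simp only [evalPoly, Finsupp.sum, Finset.smul_sum]
    refine Finset.sum_congr rfl fun α hα => ?_
    rw [word_smul, hd α hα, smul_comm]
  rw [this, h, smul_zero]

theorem mul_of_injective :
    Function.Injective fun x : FreeMonoid ι × ι => x.1 * FreeMonoid.of x.2 := by
  rintro ⟨α, i⟩ ⟨β, j⟩ h
  obtain ⟨h1, h2⟩ := List.append_inj' (show α.toList ++ [i] = β.toList ++ [j] from h) rfl
  exact Prod.ext h1 (by simpa using h2)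

theorem exists_eq_mul_of {α : FreeMonoid ι} (hα : α ≠ 1) :
    ∃ x : FreeMonoid ι × ι, x.1 * FreeMonoid.of x.2 = α := by
  rcases List.eq_nil_or_concat α.toList with h | ⟨l, i, h⟩
  · exact absurd h hα
  · exact ⟨(FreeMonoid.ofList l, i), (h.trans List.concat_eq_append).symm⟩

/-- Each nonempty word is uniquely `α g_i`. The last letter is split off because `(R_{α g_i})^* =
R_i^* R_α^*` grows words on that side. -/
theorem tsum_freeMonoid (f : FreeMonoid ι → ENNReal) :
    ∑' α, f α = f 1 + ∑' α, ∑' i, f (α * FreeMonoid.of i) := by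
  classical
  have hne : ∀ x : FreeMonoid ι × ι, x.1 * FreeMonoid.of x.2 ≠ 1 := fun x h => by
    simpa using congrArg FreeMonoid.length h
  rw [ENNReal.tsum_eq_add_tsum_ite 1, ← mul_of_injective.tsum_eq fun α hα => ?_,
    ENNReal.tsum_prod']
  · congr 1
    exact tsum_congr fun α => tsum_congr fun i => if_neg (hne (α, i))
  · refine exists_eq_mul_of fun h => hα ?_
    simp [h]

/-- If the branching weights decay geometrically, the total weight is finite, and it is carried by
the defects `f α - ∑ i, f (α g_i)`. -/
theorem tsum_defect {f d : FreeMonoid ι → ENNReal} {r : ENNReal} (hr : r < 1) (hf : f 1 ≠ ⊤)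
    (hle : ∀ α, ∑' i, f (α * FreeMonoid.of i) ≤ r * f α)
    (hd : ∀ α, d α + ∑' i, f (α * FreeMonoid.of i) = f α) : ∑' α, d α = f 1 := by
  classical
  let S : ℕ → ENNReal := fun k => ∑' α : FreeMonoid ι, if α.length = k then f α else 0
  have hS0 : S 0 = f 1 := by
    have : S 0 = ∑' α : FreeMonoid ι, if α = 1 then f α else 0 := by
      simp only [S, FreeMonoid.length_eq_zero]
    rw [this, tsum_ite_eq]
  have hS : ∀ k, S (k + 1) ≤ r * S k := fun k => by
    simp only [S]
    rw [tsum_freeMonoid, ← ENNReal.tsum_mul_left, if_neg (by simp), zero_add]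
    simp only [FreeMonoid.length_mul, FreeMonoid.length_of, Nat.add_right_cancel_iff]
    refine ENNReal.tsum_le_tsum fun α => ?_
    by_cases h : α.length = k
    · simpa [h] using hle α
    · simp [h]
  have hSk : ∀ k, S k ≤ r ^ k * f 1 := fun k => by
    induction k with
    | zero => simp [hS0]
    | succ k ih =>
      refine (hS k).trans ?_
      rw [pow_succ', mul_assoc]
      gcongr
  have htot : ∑' α, f α ≠ ⊤ := by
    have h1 : ∑' α, f α = ∑' k, S k := by
      simp only [S]
      rw [ENNReal.tsum_comm]
      refine tsum_congr fun α => ?_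
      rw [tsum_ite_eq' ]
    rw [h1]
    refine ne_top_of_le_ne_top ?_ (ENNReal.tsum_le_tsum hSk)
    rw [ENNReal.tsum_mul_right, ENNReal.tsum_geometric]
    refine ENNReal.mul_ne_top ?_ hf
    rw [Ne, ENNReal.inv_eq_top, tsub_eq_zero_iff_le]
    exact not_le.mpr hr
  have h2 : ∑' α, d α + ∑' α, ∑' i, f (α * FreeMonoid.of i) = ∑' α, f α := by
    rw [← ENNReal.tsum_add]
    exact tsum_congr hd
  -- The sum of `f` over nonempty words is finite, so it cancels from both expressions for the total
  -- weight.
  have h3 : ∑' α, ∑' i, f (α * FreeMonoid.of i) ≠ ⊤ := by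
    refine ne_top_of_le_ne_top htot ?_
    rw [← h2]
    exact le_add_self
  rw [tsum_freeMonoid f] at h2
  exact (ENNReal.add_left_inj h3).mp h2

variable [CompleteSpace H]

theorem isRowContraction_iff_sum_norm_sq_le {T : ι → H →L[ℂ] H} :
    IsRowContraction T ↔ ∀ (s : Finset ι) (h : H), ∑ i ∈ s, ‖star (T i) h‖ ^ 2 ≤ ‖h‖ ^ 2 := by
  have key : ∀ (s : Finset ι) (h : H), (inner ℂ ((1 - ∑ i ∈ s, T i * star (T i)) h) h).re =
      ‖h‖ ^ 2 - ∑ i ∈ s, ‖star (T i) h‖ ^ 2 := fun s h => by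
    simp only [sub_apply, sum_apply, inner_sub_left, sum_inner, Complex.sub_re, Complex.re_sum]
    congr 1
    · exact inner_self_eq_norm_sq (𝕜 := ℂ) h
    · refine Finset.sum_congr rfl fun i _ => ?_
      rw [mul_def, comp_apply, ← adjoint_inner_right, star_eq_adjoint]
      exact inner_self_eq_norm_sq (𝕜 := ℂ) _
  refine ⟨fun hT s h => ?_, fun hT s => ?_⟩
  · have h1 := ((ContinuousLinearMap.le_def _ _).mp (hT s)).re_inner_nonneg_left h
    rw [← sub_nonneg, ← key]
    exact h1
  · rw [ContinuousLinearMap.le_def]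
    refine ⟨isSelfAdjoint_iff_isSymmetric.mp ?_, fun h => ?_⟩
    · exact (IsSelfAdjoint.one _).sub (isSelfAdjoint_sum _ fun i _ => .mul_star_self _)
    · exact (sub_nonneg.mpr (hT s h)).trans_eq (key s h).symm

/-- The defect operator of a row contraction. -/
theorem exists_defect {R : ι → H →L[ℂ] H}
    (hR : ∀ (s : Finset ι) h, ∑ i ∈ s, ‖star (R i) h‖ ^ 2 ≤ ‖h‖ ^ 2) :
    ∃ D : H →L[ℂ] H, ∀ h, HasSum (fun i => ‖star (R i) h‖ ^ 2) (‖h‖ ^ 2 - ‖D h‖ ^ 2) := by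
  have hsum : ∀ h, Summable fun i => ‖star (R i) h‖ ^ 2 := fun h =>
    summable_of_sum_le (fun _ => by positivity) (hR · h)
  -- The column of all `R_i^*`, so that `C^* C` stands for `∑ R_i R_i^*` also when the index set is
  -- infinite.
  let C₀ : H →ₗ[ℂ] lp (fun _ : ι => H) 2 :=
    { toFun := fun h => ⟨fun i => star (R i) h, memℓp_gen (by simpa using hsum h)⟩
      map_add' := fun x y => by ext i; exact map_add _ _ _
      map_smul' := fun c x => by ext i; exact map_smul _ _ _ }
  have hC₀ : ∀ h, HasSum (fun i => ‖star (R i) h‖ ^ 2) (‖C₀ h‖ ^ 2) := fun h => by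
    have := lp.hasSum_norm (p := 2) (by simp) (C₀ h)
    simp only [ENNReal.toReal_ofNat, Real.rpow_ofNat] at this
    exact this
  have hle : ∀ h, ‖C₀ h‖ ^ 2 ≤ ‖h‖ ^ 2 := fun h =>
    hasSum_le_of_sum_le (hC₀ h) (hR · h)
  let C := C₀.mkContinuous 1 fun h => by
    rw [one_mul]
    exact (sq_le_sq₀ (norm_nonneg _) (norm_nonneg _)).mp (hle h)
  have hpos : 0 ≤ 1 - adjoint C ∘L C := by
    rw [ContinuousLinearMap.nonneg_iff_isPositive]
    refine ⟨?_, fun h => ?_⟩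
    · intro x y
      have hx : adjoint (adjoint C ∘L C) = adjoint C ∘L C := by
        rw [adjoint_comp, adjoint_adjoint]
      simp only [coe_coe, sub_apply, inner_sub_left, inner_sub_right]
      rw [← adjoint_inner_right (adjoint C ∘L C), hx]
      rfl
    · have : ((1 - adjoint C ∘L C).reApplyInnerSelf h) = ‖h‖ ^ 2 - ‖C h‖ ^ 2 := by
        rw [reApplyInnerSelf_apply, sub_apply, inner_sub_left, comp_apply, adjoint_inner_left,
          map_sub, inner_self_eq_norm_sq]
        congr 1
        exact inner_self_eq_norm_sq (𝕜 := ℂ) h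
      rw [this]
      exact sub_nonneg.mpr (hle h)
  -- Any `D` with `D^* D = 1 - C^* C` serves; only the norms `‖D h‖` matter.
  obtain ⟨D, hD⟩ := CStarAlgebra.exists_eq_star_mul_self_of_nonneg hpos
  refine ⟨D, fun h => ?_⟩
  have h1 : ‖D h‖ ^ 2 = ‖h‖ ^ 2 - ‖C h‖ ^ 2 := by
    have : inner ℂ h ((star D * D) h) = inner ℂ h ((1 - adjoint C ∘L C) h) := by rw [hD]
    rw [sub_apply, inner_sub_right, mul_def, comp_apply, comp_apply, star_eq_adjoint,
      adjoint_inner_right, adjoint_inner_right, one_apply_eq_self, inner_self_eq_norm_sq_to_K,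
      inner_self_eq_norm_sq_to_K, inner_self_eq_norm_sq_to_K] at this
    exact_mod_cast this
  have h2 : ‖h‖ ^ 2 - ‖D h‖ ^ 2 = ‖C₀ h‖ ^ 2 := by
    rw [h1]
    simp [C]
  rw [h2]
  exact hC₀ h

/-- This is the isometry of the Poisson kernel: `tsum_defect` for the weights `‖R_α^* h‖²`, whose
defects are `‖D R_α^* h‖²`. -/
theorem hasSum_defect_word {R : ι → H →L[ℂ] H} {r : ℝ} (hr0 : 0 ≤ r) (hr : r < 1)
    (hR : ∀ (s : Finset ι) h, ∑ i ∈ s, ‖star (R i) h‖ ^ 2 ≤ r * ‖h‖ ^ 2) {D : H →L[ℂ] H}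
    (hD : ∀ h, HasSum (fun i => ‖star (R i) h‖ ^ 2) (‖h‖ ^ 2 - ‖D h‖ ^ 2)) (h : H) :
    HasSum (fun α => ‖D (star (word R α) h)‖ ^ 2) (‖h‖ ^ 2) := by
  have hstep : ∀ α, ∑' i, ENNReal.ofReal (‖star (word R (α * FreeMonoid.of i)) h‖ ^ 2) =
      ENNReal.ofReal (‖star (word R α) h‖ ^ 2 - ‖D (star (word R α) h)‖ ^ 2) := fun α => by
    have h1 := hD (star (word R α) h)
    rw [← h1.tsum_eq, ENNReal.ofReal_tsum_of_nonneg (fun _ => by positivity) h1.summable]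
    refine tsum_congr fun i => ?_
    rw [word_mul, word_of, star_mul, mul_def, comp_apply]
  have key := tsum_defect (f := fun α => ENNReal.ofReal (‖star (word R α) h‖ ^ 2))
    (d := fun α => ENNReal.ofReal (‖D (star (word R α) h)‖ ^ 2)) (r := ENNReal.ofReal r)
    (by simpa using hr) ENNReal.ofReal_ne_top
    (fun α => by
      rw [hstep, ← ENNReal.ofReal_mul hr0]
      exact ENNReal.ofReal_le_ofReal (hasSum_le_of_sum_le (hD _) (hR · _)))
    (fun α => by
      have h0 := (hD (star (word R α) h)).nonneg fun _ => by positivity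
      rw [hstep, ← ENNReal.ofReal_add (by positivity) h0]
      congr 1
      ring)
  have hfin : ∑' α, ENNReal.ofReal (‖D (star (word R α) h)‖ ^ 2) ≠ ⊤ := by
    rw [key]
    exact ENNReal.ofReal_ne_top
  have h4 := ENNReal.hasSum_toReal hfin
  rw [← ENNReal.tsum_toReal_eq fun _ => ENNReal.ofReal_ne_top, key] at h4
  simpa using h4

end Words

/-! ### Poisson kernels -/

section Kernel

variable {ι : Type*} {H : Type*} [NormedAddCommGroup H] [InnerProductSpace ℂ H] [CompleteSpace H]

theorem inner_basisVec_left (α : FreeMonoid ι) (ψ : Fock ι) : inner ℂ (basisVec α) ψ = ψ α := by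
  classical
  simp [basisVec, lp.inner_single_left]

theorem adjoint_creation_apply (i : ι) (ψ : Fock ι) (α : FreeMonoid ι) :
    adjoint (creation i) ψ α = ψ (FreeMonoid.of i * α) := by
  rw [← inner_basisVec_left, adjoint_inner_right, creation_basisVec, inner_basisVec_left]

/-- The coordinates of `S_i^* ψ` are those of `ψ` at words beginning with `g_i`, and these sets of
words are disjoint. -/
theorem sum_norm_sq_adjoint_creation_le (s : Finset ι) (ψ : Fock ι) :
    ∑ i ∈ s, ‖adjoint (creation i) ψ‖ ^ 2 ≤ ‖ψ‖ ^ 2 := by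
  have hn : ∀ φ : Fock ι, HasSum (fun α => ‖φ α‖ ^ 2) (‖φ‖ ^ 2) := fun φ => by
    simpa using lp.hasSum_norm (p := 2) (by simp) φ
  have hinj : Function.Injective fun x : s × FreeMonoid ι => FreeMonoid.of (x.1 : ι) * x.2 := by
    rintro ⟨⟨i, hi⟩, α⟩ ⟨⟨j, hj⟩, β⟩ h
    obtain ⟨h1, h2⟩ := List.cons_eq_cons.mp (show i :: α.toList = j :: β.toList from h)
    exact Prod.ext (Subtype.ext h1) h2
  have hsum := (hn ψ).summable.comp_injective hinj
  have hfib := hsum.hasSum.prod_fiberwise (g := fun i : s => ‖adjoint (creation (i : ι)) ψ‖ ^ 2)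
    fun i => by
      simpa only [adjoint_creation_apply, Function.comp_def] using
        hn (adjoint (creation (i : ι)) ψ)
  rw [← Finset.sum_coe_sort, ← (hn ψ).tsum_eq, ← tsum_fintype (L := .unconditional _), hfib.tsum_eq]
  exact hsum.tsum_le_tsum_of_inj _ hinj (fun _ _ => by positivity) (fun _ => le_rfl) (hn ψ).summable

/-- The components of the Poisson kernel of a strict row contraction in an orthonormal basis. -/
theorem exists_poissonKernel {R : ι → H →L[ℂ] H} {r : ℝ} (hr0 : 0 ≤ r) (hr : r < 1)
    (hR : ∀ (s : Finset ι) h, ∑ i ∈ s, ‖star (R i) h‖ ^ 2 ≤ r * ‖h‖ ^ 2) :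
    ∃ (w : Set H) (K : w → H →L[ℂ] Fock ι), (∀ h, HasSum (fun j => ‖K j h‖ ^ 2) (‖h‖ ^ 2)) ∧
      ∀ j i h, adjoint (creation i) (K j h) = K j (star (R i) h) := by
  obtain ⟨D, hD⟩ := exists_defect (R := R) fun s h =>
    (hR s h).trans (mul_le_of_le_one_left (by positivity) hr.le)
  have hw := hasSum_defect_word hr0 hr hR hD
  have hb : ∀ (g h : H) α, ‖inner ℂ g (D (star (word R α) h))‖ ^ 2 ≤
      ‖g‖ ^ 2 * ‖D (star (word R α) h)‖ ^ 2 := fun g h α => by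
    rw [← mul_pow]
    gcongr
    exact norm_inner_le_norm _ _
  have hs : ∀ g h, Summable fun α => ‖inner ℂ g (D (star (word R α) h))‖ ^ 2 := fun g h =>
    Summable.of_nonneg_of_le (fun _ => by positivity) (hb g h) ((hw h).summable.mul_left _)
  -- The component along `g` of `∑_α e_α ⊗ D R_α^* h`.
  let K₀ : H → H →ₗ[ℂ] Fock ι := fun g =>
    { toFun := fun h => ⟨fun α => inner ℂ g (D (star (word R α) h)),
        memℓp_gen (by simpa using hs g h)⟩
      map_add' := fun x y => by
        ext α
        simp only [map_add, inner_add_right]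
        rfl
      map_smul' := fun c x => by
        ext α
        simp only [map_smul, inner_smul_right]
        rfl }
  have hK₀ : ∀ g h, HasSum (fun α => ‖inner ℂ g (D (star (word R α) h))‖ ^ 2) (‖K₀ g h‖ ^ 2) :=
    fun g h => by
      have := lp.hasSum_norm (p := 2) (by simp) (K₀ g h)
      simp only [ENNReal.toReal_ofNat, Real.rpow_ofNat] at this
      exact this
  let K : H → H →L[ℂ] Fock ι := fun g => (K₀ g).mkContinuous ‖g‖ fun h => by
    rw [← sq_le_sq₀ (norm_nonneg _) (by positivity), mul_pow]
    exact hasSum_le (hb g h) (hK₀ g h) ((hw h).mul_left _)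
  obtain ⟨w, b, hbw⟩ := exists_hilbertBasis ℂ H
  refine ⟨w, fun j => K j, fun h => ?_, fun j i h => ?_⟩
  · have hp : ∀ α, HasSum (fun j : w => ‖inner ℂ (j : H) (D (star (word R α) h))‖ ^ 2)
        (‖D (star (word R α) h)‖ ^ 2) := fun α => by
      have := b.hasSum_inner_mul_inner (D (star (word R α) h)) (D (star (word R α) h))
      rw [inner_self_eq_norm_sq_to_K, hbw] at this
      convert! Complex.hasSum_re this using 1
      · funext j
        rw [← inner_conj_symm, RCLike.norm_conj, Complex.mul_conj']
        norm_cast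
      · norm_cast
    have hprod : Summable fun x : FreeMonoid ι × w =>
        ‖inner ℂ (x.2 : H) (D (star (word R x.1) h))‖ ^ 2 := by
      rw [summable_prod_of_nonneg fun _ => by positivity]
      refine ⟨fun α => (hp α).summable, ?_⟩
      simp only [(hp _).tsum_eq]
      exact (hw h).summable
    -- Parseval in `j` followed by the sum over `α` gives `‖h‖²`; nonnegativity allows the order of
    -- summation to be exchanged.
    have hsw := hprod.hasSum
    rw [(hprod.hasSum.prod_fiberwise hp).unique (hw h)] at hsw
    have := ((Equiv.prodComm w (FreeMonoid ι)).hasSum_iff.mpr hsw).prod_fiberwise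
      fun j => hK₀ j h
    exact this
  · ext α
    rw [adjoint_creation_apply]
    change inner ℂ (j : H) (D (star (word R _) h)) = inner ℂ (j : H) (D (star (word R α) _))
    rw [word_mul, word_of, star_mul, mul_def, comp_apply]

end Kernel

/-! ### The ideal of the relations and its co-invariant space -/

section Ideal

variable {ι : Type*} {P : Set (MonoidAlgebra ℂ (FreeMonoid ι))}

theorem WOTClosed.sInf {E : Type*} [NormedAddCommGroup E] [InnerProductSpace ℂ E]
    {S : Set (Set (E →L[ℂ] E))} (h : ∀ X ∈ S, WOTClosed X) : WOTClosed (⋂₀ S) := by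
  unfold WOTClosed
  rw [Set.preimage_sInter]
  exact isClosed_biInter h

theorem wotClosed_setOf_inner_eq_zero {E : Type*} [NormedAddCommGroup E] [InnerProductSpace ℂ E]
    (x y : E) : WOTClosed {f : E →L[ℂ] E | inner ℂ x (f y) = 0} := by
  have h : Continuous fun f : E →WOT[ℂ] E => inner ℂ x (f y) :=
    ContinuousLinearMapWOT.continuous_dual_apply y (innerSL ℂ x)
  exact isClosed_singleton.preimage h

theorem creation_mem_toeplitzAlgebra (i : ι) : creation i ∈ toeplitzAlgebra ι :=
  Algebra.mem_sInf.mpr fun _ hA => hA.1 i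

theorem wotClosed_toeplitzAlgebra :
    WOTClosed (toeplitzAlgebra ι : Set (Fock ι →L[ℂ] Fock ι)) := by
  rw [toeplitzAlgebra, Algebra.coe_sInf, ← Set.sInter_image]
  refine WOTClosed.sInf ?_
  rintro _ ⟨A, hA, rfl⟩
  exact hA.2

theorem evalPoly_mem {A : Subalgebra ℂ (Fock ι →L[ℂ] Fock ι)} (hA : ∀ i, creation i ∈ A)
    (p : MonoidAlgebra ℂ (FreeMonoid ι)) : evalPoly creation p ∈ A := by
  refine sum_mem fun α hα => A.smul_mem ?_ _
  clear hα
  induction α using FreeMonoid.inductionOn' with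
  | one => simp
  | of_mul i α ih => rw [word_mul, word_of]; exact mul_mem (hA i) ih

theorem creation_mul_mem_relationIdeal (i : ι) {f : Fock ι →L[ℂ] Fock ι}
    (hf : f ∈ relationIdeal P) : creation i * f ∈ relationIdeal P := by
  rw [relationIdeal, Submodule.mem_sInf] at hf ⊢
  exact fun I hI => hI.1.mul_mem_left _ (creation_mem_toeplitzAlgebra i) _ (hf I hI)

theorem evalPoly_mem_relationIdeal {p : MonoidAlgebra ℂ (FreeMonoid ι)} (hp : p ∈ P) :
    evalPoly creation p ∈ relationIdeal P :=
  Submodule.mem_sInf.mpr fun _ hI => hI.2 p hp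

theorem mem_quotientSpace {ψ : Fock ι} :
    ψ ∈ quotientSpace P ↔ ∀ f ∈ relationIdeal P, ∀ ξ, inner ℂ (f ξ) ψ = 0 := by
  rw [quotientSpace, Submodule.mem_orthogonal]
  refine ⟨fun h f hf ξ => h _ (Submodule.subset_span ⟨f, hf, ξ, rfl⟩), fun h u hu => ?_⟩
  induction hu using Submodule.span_induction with
  | mem x hx => obtain ⟨f, hf, ξ, rfl⟩ := hx; exact h f hf ξ
  | zero => simp
  | add x y _ _ hx hy => rw [inner_add_left, hx, hy, add_zero]
  | smul c x _ hx => rw [inner_smul_left, hx, mul_zero]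

/-- `J` is a left ideal, so `S_i` preserves its range and `S_i^*` preserves the orthogonal
complement. -/
theorem adjoint_creation_mem_quotientSpace (i : ι) {ψ : Fock ι} (hψ : ψ ∈ quotientSpace P) :
    adjoint (creation i) ψ ∈ quotientSpace P := by
  rw [mem_quotientSpace] at hψ ⊢
  intro f hf ξ
  rw [adjoint_inner_right]
  exact hψ _ (creation_mul_mem_relationIdeal i hf) ξ

theorem coe_adjoint_compression (i : ι) (ψ : quotientSpace P) :
    (adjoint (compression P i) ψ : Fock ι) = adjoint (creation i) (ψ : Fock ι) := by
  have : adjoint (compression P i) ψ =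
      ⟨_, adjoint_creation_mem_quotientSpace i ψ.2⟩ := by
    refine ext_inner_left ℂ fun φ => ?_
    rw [adjoint_inner_right]
    change inner ℂ ((quotientSpace P).orthogonalProjectionOnto (creation i (φ : Fock ι))) ψ =
      inner ℂ (φ : Fock ι) (adjoint (creation i) (ψ : Fock ι))
    rw [adjoint_inner_right, Submodule.inner_orthogonalProjectionOnto_eq_of_mem_right]
  rw [this]

theorem coe_star_word_compression (α : FreeMonoid ι) (ψ : quotientSpace P) :
    (star (word (compression P) α) ψ : Fock ι) = star (word creation α) (ψ : Fock ι) := by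
  induction α using FreeMonoid.inductionOn' generalizing ψ with
  | one => simp
  | of_mul i α ih =>
    rw [word_mul, word_mul, star_mul, star_mul, mul_def, mul_def, comp_apply, comp_apply, ih,
      word_of, word_of, star_eq_adjoint (compression P i), star_eq_adjoint (creation i),
      coe_adjoint_compression]

/-- By co-invariance `B_α` is the compression of `S_α`, so `p(B)` is the compression of `p(S) ∈ J`,
whose range is orthogonal to `N_J`. -/
theorem evalPoly_compression_eq_zero {p : MonoidAlgebra ℂ (FreeMonoid ι)} (hp : p ∈ P) :
    evalPoly (compression P) p = 0 := by
  ext1 φ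
  refine ext_inner_right ℂ fun ψ => ?_
  have h := mem_quotientSpace.mp ψ.2 _ (evalPoly_mem_relationIdeal hp) (φ : Fock ι)
  rw [zero_apply, inner_zero_left, ← h]
  simp only [evalPoly, Finsupp.sum, sum_apply, sum_inner, smul_apply]
  refine Finset.sum_congr rfl fun α _ => ?_
  rw [inner_smul_left]
  refine (inner_smul_left (𝕜 := ℂ) (word (compression P) α φ) ψ _).trans (congrArg _ ?_)
  rw [← adjoint_inner_right, ← adjoint_inner_right, ← star_eq_adjoint, ← star_eq_adjoint,
    ← coe_star_word_compression]
  rfl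

/-- An operator that intertwines the adjoints of the creation operators with the adjoints of a tuple
that satisfies the relations has its range in the co-invariant space. -/
theorem mem_quotientSpace_of_intertwining {H : Type*} [NormedAddCommGroup H]
    [InnerProductSpace ℂ H] [CompleteSpace H] {R : ι → H →L[ℂ] H} {K : H →L[ℂ] Fock ι}
    (hK : ∀ i h, adjoint (creation i) (K h) = K (star (R i) h))
    (hR : ∀ p ∈ P, evalPoly R p = 0) (h : H) : K h ∈ quotientSpace P := by
  have hword : ∀ α h, star (word creation α) (K h) = K (star (word R α) h) := by
    intro α
    induction α using FreeMonoid.inductionOn' with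
    | one => simp
    | of_mul i α ih =>
      intro h
      rw [word_mul, word_mul, star_mul, star_mul, mul_def, mul_def, comp_apply, comp_apply,
        word_of, word_of, star_eq_adjoint (creation i), hK, ih]
  -- `V` is the orthogonal complement of the range of `K`. The intertwining relation makes it
  -- invariant under each `S_i`, hence under the whole Toeplitz algebra, since the operators
  -- preserving `V` form a WOT-closed algebra.
  let V : Submodule ℂ (Fock ι) := (adjoint K).ker
  have hV : ∀ v, v ∈ V ↔ ∀ g, inner ℂ (K g) v = 0 := fun v => by
    rw [LinearMap.mem_ker]
    refine ⟨fun hv g => ?_, fun hv => ext_inner_left ℂ fun g => ?_⟩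
    · rw [← adjoint_inner_right]
      exact (congrArg (inner ℂ g) hv).trans (inner_zero_right _)
    · rw [inner_zero_right]
      exact (adjoint_inner_right K g v).trans (hv g)
  let A : Subalgebra ℂ (Fock ι →L[ℂ] Fock ι) :=
    { carrier := {f | ∀ v ∈ V, f v ∈ V}
      mul_mem' := fun ha hb v hv => ha _ (hb v hv)
      add_mem' := fun ha hb v hv => V.add_mem (ha v hv) (hb v hv)
      algebraMap_mem' := fun c v hv => V.smul_mem c hv }
  have hA : ∀ f, f ∈ A ↔ ∀ v ∈ V, f v ∈ V := fun f => Iff.rfl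
  have hAS : ∀ i, creation i ∈ A := fun i v hv => by
    rw [hV] at hv ⊢
    intro g
    rw [← adjoint_inner_left, hK, hv]
  have hAle : toeplitzAlgebra ι ≤ A := by
    refine sInf_le ⟨hAS, ?_⟩
    have : (A : Set (Fock ι →L[ℂ] Fock ι)) =
        ⋂₀ Set.range fun x : V × H => {f | inner ℂ (K x.2) (f (x.1 : Fock ι)) = 0} := by
      ext f
      simp [hA, hV]
    rw [this]
    refine WOTClosed.sInf ?_
    rintro _ ⟨x, rfl⟩
    exact wotClosed_setOf_inner_eq_zero _ _
  -- The Toeplitz operators with range in `V` form a WOT-closed ideal. It contains each `p(S)`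
  -- because `K^* p(S) = p(R) K^* = 0`, so it contains `J` by minimality.
  let I : Submodule ℂ (Fock ι →L[ℂ] Fock ι) :=
    { carrier := {f | f ∈ toeplitzAlgebra ι ∧ ∀ ξ, f ξ ∈ V}
      add_mem' := fun ha hb => ⟨add_mem ha.1 hb.1, fun ξ => V.add_mem (ha.2 ξ) (hb.2 ξ)⟩
      zero_mem' := ⟨zero_mem _, fun ξ => V.zero_mem⟩
      smul_mem' := fun c f hf => ⟨Subalgebra.smul_mem _ hf.1 c, fun ξ => V.smul_mem c (hf.2 ξ)⟩ }
  have hI : ∀ f, f ∈ I ↔ f ∈ toeplitzAlgebra ι ∧ ∀ ξ, f ξ ∈ V := fun f => Iff.rfl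
  have hIdeal : IsWOTClosedIdeal I :=
    { subset := fun x hx => hx.1
      mul_mem_left := fun f hf x hx => ⟨mul_mem hf hx.1, fun ξ => hAle hf _ (hx.2 ξ)⟩
      mul_mem_right := fun f hf x hx => ⟨mul_mem hx.1 hf, fun ξ => hx.2 (f ξ)⟩
      closed := by
        have : (I : Set (Fock ι →L[ℂ] Fock ι)) = ⋂₀ insert (toeplitzAlgebra ι : Set _)
            (Set.range fun x : Fock ι × H => {f | inner ℂ (K x.2) (f x.1) = 0}) := by
          ext f
          simp [hI, hV]
        rw [this]
        refine WOTClosed.sInf ?_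
        rintro _ (rfl | ⟨x, rfl⟩)
        · exact wotClosed_toeplitzAlgebra
        · exact wotClosed_setOf_inner_eq_zero _ _ }
  have hle : relationIdeal P ≤ I := by
    refine sInf_le ⟨hIdeal, fun p hp => ⟨evalPoly_mem creation_mem_toeplitzAlgebra p, fun ξ => ?_⟩⟩
    rw [hV]
    intro g
    have h1 : inner ℂ (K g) (evalPoly creation p ξ) =
        inner ℂ g (evalPoly R p (adjoint K ξ)) := by
      simp only [evalPoly, Finsupp.sum, sum_apply, inner_sum, smul_apply, inner_smul_right]
      refine Finset.sum_congr rfl fun α _ => congrArg _ ?_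
      rw [← adjoint_inner_left, ← star_eq_adjoint, hword, ← adjoint_inner_left (word R α),
        ← star_eq_adjoint, adjoint_inner_right]
    rw [h1, hR p hp, zero_apply, inner_zero_right]
  rw [mem_quotientSpace]
  intro f hf ξ
  rw [← inner_conj_symm, (hV _).mp ((hle hf).2 ξ) h, map_zero]

end Ideal

/-! ### Existence of Poisson transforms -/

section Existence

variable {ι : Type*} {P : Set (MonoidAlgebra ℂ (FreeMonoid ι))}
  {H : Type*} [NormedAddCommGroup H] [InnerProductSpace ℂ H] [CompleteSpace H]

/-- A decomposition of the identity that intertwines two tuples of adjoints yields a map that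
represents one of the tuples by means of the other. -/
theorem exists_representing_of_hasSum {E : Type*} [NormedAddCommGroup E] [InnerProductSpace ℂ E]
    [CompleteSpace E] {B : ι → E →L[ℂ] E} {R : ι → H →L[ℂ] H} {κ : Type*} {L : κ → H →L[ℂ] E}
    (hL : ∀ h, HasSum (fun j => ‖L j h‖ ^ 2) (‖h‖ ^ 2))
    (hLi : ∀ j i h, star (B i) (L j h) = L j (star (R i) h)) :
    ∃ φ : cstarGenerated B →ₗ[ℂ] (H →L[ℂ] H),
      IsPositiveDefinite (A := cstarGenerated B) φ ∧ Represents B R φ := by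
  classical
  have hLw : ∀ j α h, star (word B α) (L j h) = L j (star (word R α) h) := by
    intro j α
    induction α using FreeMonoid.inductionOn' with
    | one => simp
    | of_mul i α ih =>
      intro h
      rw [word_mul, word_mul, star_mul, star_mul, mul_def, mul_def, comp_apply, comp_apply,
        word_of, word_of, ← ih, hLi]
  have hinner : ∀ g h, HasSum (fun j => inner ℂ (L j g) (L j h)) (inner ℂ g h) := by
    intro g h
    have hc : ∀ x, HasSum (fun j => ((‖L j x‖ : ℂ)) ^ 2) ((‖x‖ : ℂ) ^ 2) := fun x => by
      exact_mod_cast Complex.hasSum_ofReal.mpr (hL x)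
    -- Polarization turns the summed norms into summed inner products.
    have := ((((hc (g + h)).sub (hc (g - h))).add
      (((hc (g - Complex.I • h)).sub (hc (g + Complex.I • h))).mul_right Complex.I)).div_const 4)
    convert! this using 1
    · funext j
      rw [inner_eq_sum_norm_sq_div_four]
      simp only [map_add, map_sub, map_smul]
      rfl
    · exact inner_eq_sum_norm_sq_div_four g h
  -- The partial sums `∑_{j ∈ s} L_j^* X L_j` over finite `s` replace `K^* (X ⊗ 1) K`; a limit along
  -- an ultrafilter finer than `atTop` suffices.
  have hfin : ∀ s : Finset κ, ∃ φ : cstarGenerated B →ₗ[ℂ] (H →L[ℂ] H),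
      IsPositiveDefinite (A := cstarGenerated B) φ ∧ ∀ a g h, inner ℂ g (φ a h) =
        ∑ j ∈ s, inner ℂ (L j g) ((cstarGenerated B).subtype a (L j h)) :=
    fun s => exists_sum_compression (A := cstarGenerated B) (cstarGenerated B).subtype s L
      fun h => sum_le_hasSum s (fun _ _ => by positivity) (hL h)
  choose φ hφ hφL using hfin
  obtain ⟨ψ, hψ, hlim⟩ := exists_ultrafilter_limit (A := cstarGenerated B)
    (Ultrafilter.of atTop) φ hφ
  refine ⟨ψ, hψ, fun α β => ?_⟩
  ext h
  refine ext_inner_left ℂ fun g => tendsto_nhds_unique (hlim _ g h) ?_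
  have h1 := (hinner (star (word R α) g) (star (word R β) h)).mono_left
    (Ultrafilter.of_le (atTop : Filter (Finset κ)))
  have h2 : inner ℂ g ((word R α * star (word R β)) h) =
      inner ℂ (star (word R α) g) (star (word R β) h) := by
    rw [mul_def, comp_apply, star_eq_adjoint (word R α), adjoint_inner_left]
  rw [h2]
  refine h1.congr fun s => ?_
  rw [hφL]
  refine Finset.sum_congr rfl fun j _ => ?_
  beta_reduce
  rw [← hLw, ← hLw, star_eq_adjoint (word B α), adjoint_inner_left]
  rfl

/-- The components of the Poisson kernel take values in `N_J`, where `S_i^*` acts as `B_i^*`. -/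
theorem exists_representing_of_strict {R : ι → H →L[ℂ] H} {r : ℝ} (hr0 : 0 ≤ r) (hr : r < 1)
    (hR : ∀ (s : Finset ι) h, ∑ i ∈ s, ‖star (R i) h‖ ^ 2 ≤ r * ‖h‖ ^ 2)
    (hRP : ∀ p ∈ P, evalPoly R p = 0) :
    ∃ φ : cstarGenerated (compression P) →ₗ[ℂ] (H →L[ℂ] H),
      IsPositiveDefinite (A := cstarGenerated (compression P)) φ ∧
        Represents (compression P) R φ := by
  obtain ⟨w, K, hK, hKi⟩ := exists_poissonKernel hr0 hr hR
  refine exists_representing_of_hasSum (B := compression P)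
    (L := fun j => (K j).codRestrict _ (mem_quotientSpace_of_intertwining (hKi j) hRP)) hK
    fun j i h => Subtype.ext ?_
  rw [star_eq_adjoint, coe_adjoint_compression]
  exact hKi j i h

theorem exists_representing {T : ι → H →L[ℂ] H} (hP : ∀ p ∈ P, IsHomogeneous p)
    (hT : IsRowContraction T) (hTP : ∀ p ∈ P, evalPoly T p = 0) :
    ∃ φ : cstarGenerated (compression P) →ₗ[ℂ] (H →L[ℂ] H),
      IsPositiveDefinite (A := cstarGenerated (compression P)) φ ∧ Represents (compression P) T φ := by
  let r : ℕ → ℝ := fun n => 1 - 1 / ((n : ℝ) + 1)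
  have hr0 : ∀ n, 0 ≤ r n := fun n => by
    have : 1 / ((n : ℝ) + 1) ≤ 1 := by
      rw [div_le_one (by positivity)]
      linarith [(Nat.cast_nonneg n : (0 : ℝ) ≤ n)]
    exact sub_nonneg.mpr this
  have hr1 : ∀ n, r n < 1 := fun n => sub_lt_self _ (by positivity)
  have hr : Tendsto r atTop (𝓝 1) := by
    simpa [r] using (tendsto_one_div_add_atTop_nhds_zero_nat (𝕜 := ℝ)).const_sub 1
  have hstrict : ∀ n, ∃ φ : cstarGenerated (compression P) →ₗ[ℂ] (H →L[ℂ] H),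
      IsPositiveDefinite (A := cstarGenerated (compression P)) φ ∧
        Represents (compression P) (fun i => (r n : ℂ) • T i) φ := fun n => by
    -- Scaling `T` by `r n` scales the squared norms, hence the row bound, by `r n ^ 2`.
    refine exists_representing_of_strict (r := r n ^ 2) (by positivity)
      (pow_lt_one₀ (hr0 n) (hr1 n) two_ne_zero) (fun s h => ?_)
      fun p hp => evalPoly_smul_eq_zero (hP p hp) (hTP p hp)
    have : ∑ i ∈ s, ‖star ((r n : ℂ) • T i) h‖ ^ 2 = r n ^ 2 * ∑ i ∈ s, ‖star (T i) h‖ ^ 2 := by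
      rw [Finset.mul_sum]
      refine Finset.sum_congr rfl fun i _ => ?_
      rw [star_smul, smul_apply, norm_smul, mul_pow]
      simp
    rw [this]
    gcongr
    exact isRowContraction_iff_sum_norm_sq_le.mp hT s h
  choose φ hφ hφT using hstrict
  obtain ⟨ψ, hψ, hlim⟩ := exists_ultrafilter_limit (A := cstarGenerated (compression P))
    (Ultrafilter.of atTop) φ hφ
  refine ⟨ψ, hψ, fun α β => ?_⟩
  ext h
  refine ext_inner_left ℂ fun g => tendsto_nhds_unique (hlim _ g h) ?_
  have hrc : Tendsto (fun n => (r n : ℂ)) ((Ultrafilter.of atTop : Ultrafilter ℕ) : Filter ℕ) (𝓝 1) := by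
    have := (Complex.continuous_ofReal.tendsto 1).comp hr
    exact (this.mono_left (Ultrafilter.of_le _))
  have h1 : Tendsto (fun n => (r n : ℂ) ^ α.length * (r n : ℂ) ^ β.length *
      inner ℂ g ((word T α * star (word T β)) h)) ((Ultrafilter.of atTop : Ultrafilter ℕ) : Filter ℕ)
      (𝓝 (inner ℂ g ((word T α * star (word T β)) h))) := by
    simpa using ((hrc.pow α.length).mul (hrc.pow β.length)).mul_const
      (inner ℂ g ((word T α * star (word T β)) h))
  refine h1.congr fun n => ?_
  rw [hφT, word_smul, word_smul, star_smul, smul_mul_smul_comm, smul_apply, inner_smul_right]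
  simp

end Existence

/-! ### Poisson transforms and row contractions -/

section Transforms

variable {ι : Type*} {E : Type*} [NormedAddCommGroup E] [InnerProductSpace ℂ E] [CompleteSpace E]
  {H : Type*} [NormedAddCommGroup H] [InnerProductSpace ℂ H] [CompleteSpace H]
  {B : ι → E →L[ℂ] E} {μ : cstarGenerated B →ₗ[ℂ] (H →L[ℂ] H)}

theorem gword_one : gword B 1 = 1 := Subtype.ext (word_one B)

theorem gword_mul (α β : FreeMonoid ι) : gword B (α * β) = gword B α * gword B β :=
  Subtype.ext (word_mul B α β)

theorem word_mem_discAlgebra (α : FreeMonoid ι) : word B α ∈ discAlgebra B := by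
  refine Subalgebra.le_topologicalClosure _ ?_
  induction α using FreeMonoid.inductionOn' with
  | one => simp
  | of_mul i α ih =>
    rw [word_mul, word_of]
    exact mul_mem (Algebra.subset_adjoin ⟨i, rfl⟩) ih

omit [CompleteSpace E] in
theorem adjoin_range_eq_span :
    Subalgebra.toSubmodule (Algebra.adjoin ℂ (Set.range B)) =
      Submodule.span ℂ (Set.range (word B)) := by
  rw [Algebra.adjoin_eq_span]
  refine congrArg (Submodule.span ℂ) ?_
  rw [← FreeMonoid.mrange_lift]
  rfl

/-- Closed conditions on the norm-closed algebra may be checked on linear combinations of words. -/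
theorem discAlgebra_induction {p : cstarGenerated B → Prop} (hcl : IsClosed {x | p x})
    (hw : ∀ α, p (gword B α)) (h0 : p 0) (hadd : ∀ x y, p x → p y → p (x + y))
    (hsmul : ∀ (c : ℂ) x, p x → p (c • x)) {x : cstarGenerated B}
    (hx : (x : E →L[ℂ] E) ∈ discAlgebra B) : p x := by
  have h1 : x ∈ closure (Submodule.span ℂ (Set.range (gword B)) : Set (cstarGenerated B)) := by
    rw [closure_subtype]
    have h2 : (Algebra.adjoin ℂ (Set.range B) : Set (E →L[ℂ] E)) =
        Subtype.val '' (Submodule.span ℂ (Set.range (gword B)) : Set (cstarGenerated B)) := by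
      have h3 := Submodule.map_span (cstarGenerated B).subtype.toAlgHom.toLinearMap
        (Set.range (gword B))
      rw [← Set.range_comp] at h3
      have h4 := congrArg (fun S : Submodule ℂ (E →L[ℂ] E) => (S : Set (E →L[ℂ] E)))
        ((adjoin_range_eq_span (B := B)).trans h3.symm)
      exact h4
    rw [← h2]
    exact hx
  refine closure_minimal (fun y hy => ?_) hcl h1
  induction hy using Submodule.span_induction with
  | mem y hy => obtain ⟨α, rfl⟩ := hy; exact hw α
  | zero => exact h0
  | add y z _ _ hy hz => exact hadd y z hy hz
  | smul c y _ hy => exact hsmul c y hy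

/-- Complete positivity makes `μ` continuous, so each of `A`, `C`, `D` may be reduced to a word,
where `B_α B_β B_γ^* = B_{αβ} B_γ^*` and `(*)` applies. -/
theorem Represents.isPoissonTransform {T : ι → H →L[ℂ] H} (hT : Represents B T μ)
    (hμ : IsCompletelyPositive (A := cstarGenerated B) (A' := H →L[ℂ] H) μ) :
    IsPoissonTransform B μ := by
  have hc : Continuous μ := hμ.continuous
  have h1 : ∀ α, μ (gword B α) = word T α := fun α => by
    simpa [gword_one] using hT α 1
  refine ⟨by simpa [gword_one] using h1 1, hμ, fun A C D hA hC hD => ?_⟩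
  refine discAlgebra_induction (p := fun A => μ (A * (C * star D)) = μ A * μ (C * star D))
    (isClosed_eq (by fun_prop) (by fun_prop)) (fun α => ?_) (by simp)
    (fun x y hx hy => by rw [add_mul, map_add, map_add, add_mul, hx, hy])
    (fun c x hx => by rw [smul_mul_assoc, map_smul, map_smul, smul_mul_assoc, hx]) hA
  refine discAlgebra_induction
    (p := fun C => μ (gword B α * (C * star D)) = μ (gword B α) * μ (C * star D))
    (isClosed_eq (by fun_prop) (by fun_prop)) (fun β => ?_) (by simp)
    (fun x y hx hy => by rw [add_mul, mul_add, map_add, map_add, mul_add, hx, hy])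
    (fun c x hx => by
      rw [smul_mul_assoc, mul_smul_comm, map_smul, map_smul, mul_smul_comm, hx]) hC
  refine discAlgebra_induction (p := fun D => μ (gword B α * (gword B β * star D)) =
      μ (gword B α) * μ (gword B β * star D))
    (isClosed_eq (by fun_prop) (by fun_prop)) (fun γ => ?_) (by simp)
    (fun x y hx hy => by rw [star_add, mul_add, mul_add, map_add, map_add, mul_add, hx, hy])
    (fun c x hx => by
      rw [star_smul, mul_smul_comm, mul_smul_comm, map_smul, map_smul, mul_smul_comm, hx]) hD
  rw [hT, h1, ← mul_assoc, ← gword_mul, hT, word_mul, mul_assoc]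

theorem IsPoissonTransform.map_gword (hμ : IsPoissonTransform B μ) (α : FreeMonoid ι) :
    μ (gword B α) = word (fun i => μ (gword B (FreeMonoid.of i))) α := by
  induction α using FreeMonoid.inductionOn' with
  | one => rw [gword_one, hμ.map_one, word_one]
  | of_mul i α ih =>
    have h := hμ.map_mul (gword B (FreeMonoid.of i)) (gword B α) 1 (word_mem_discAlgebra _)
      (word_mem_discAlgebra _) (one_mem (discAlgebra B))
    rw [star_one, mul_one] at h
    rw [gword_mul, h, word_mul, word_of, ih]

/-- Multiplicativity with `C = 1` separates `B_α` from `B_β^*`, and a completely positive map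
commutes with the adjoint. -/
theorem IsPoissonTransform.represents (hμ : IsPoissonTransform B μ) :
    Represents B (fun i => μ (gword B (FreeMonoid.of i))) μ := fun α β => by
  have h := hμ.map_mul (gword B α) 1 (gword B β) (word_mem_discAlgebra _)
    (one_mem (discAlgebra B)) (word_mem_discAlgebra _)
  have hs : μ (star (gword B β)) = star (μ (gword B β)) := hμ.completelyPositive.map_star _
  rw [one_mul] at h
  rw [h, hs, hμ.map_gword, hμ.map_gword]

theorem IsPoissonTransform.evalPoly_eq_zero (hμ : IsPoissonTransform B μ)
    {p : MonoidAlgebra ℂ (FreeMonoid ι)} (hp : evalPoly B p = 0) :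
    evalPoly (fun i => μ (gword B (FreeMonoid.of i))) p = 0 := by
  have h1 : p.coeff.sum (fun α a => a • gword B α) = 0 := by
    apply Subtype.ext
    rw [ZeroMemClass.coe_zero, ← hp]
    simp only [evalPoly, Finsupp.sum]
    push_cast
    rfl
  have h2 := congrArg μ h1
  rw [map_zero] at h2
  rw [← h2]
  simp only [evalPoly, Finsupp.sum, map_sum, map_smul]
  exact Finset.sum_congr rfl fun α _ => by rw [← hμ.map_gword]

theorem IsPoissonTransform.isRowContraction (hμ : IsPoissonTransform B μ)
    (hB : IsRowContraction B) :
    IsRowContraction fun i => μ (gword B (FreeMonoid.of i)) := by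
  intro s
  have h0 : 0 ≤ ∑ i ∈ s, B i * star (B i) := Finset.sum_nonneg fun i _ => mul_star_self_nonneg _
  -- The bound is passed to the generated C*-algebra as a norm inequality, which needs no comparison
  -- of the two orders.
  have h1 : ‖∑ i ∈ s, B i * star (B i)‖ ≤ 1 :=
    (CStarAlgebra.norm_le_one_iff_of_nonneg _ h0).mpr (hB s)
  have h2 : ‖∑ i ∈ s, gword B (FreeMonoid.of i) * star (gword B (FreeMonoid.of i))‖ ≤ 1 := by
    have h3 : ((∑ i ∈ s, gword B (FreeMonoid.of i) * star (gword B (FreeMonoid.of i)) :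
        cstarGenerated B) : E →L[ℂ] E) = ∑ i ∈ s, B i * star (B i) := by
      rw [AddSubmonoidClass.coe_finsetSum]
      refine Finset.sum_congr rfl fun i _ => ?_
      change word B _ * star (word B _) = _
      rw [word_of]
    exact (congrArg norm h3).trans_le h1
  obtain ⟨b, hb⟩ := IsCompletelyPositive.exists_map_one_sub_eq hμ.completelyPositive s _ h2
  have h3 : ∀ i, μ (gword B (FreeMonoid.of i) * star (gword B (FreeMonoid.of i))) =
      μ (gword B (FreeMonoid.of i)) * star (μ (gword B (FreeMonoid.of i))) := fun i => by
    simpa only [word_of] using hμ.represents (FreeMonoid.of i) (FreeMonoid.of i)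
  simp only [h3, hμ.map_one] at hb
  rw [← sub_nonneg, hb]
  exact star_mul_self_nonneg b

end Transforms

theorem isRowContraction_compression {ι : Type*} (P : Set (MonoidAlgebra ℂ (FreeMonoid ι))) :
    IsRowContraction (compression P) := by
  refine isRowContraction_iff_sum_norm_sq_le.mpr fun s ψ => ?_
  have h : ∀ i, ‖star (compression P i) ψ‖ = ‖adjoint (creation i) (ψ : Fock ι)‖ := fun i => by
    rw [← coe_adjoint_compression]
    rfl
  simp only [h]
  exact sum_norm_sq_adjoint_creation_le s _

end Poisson

end

theorem theorem4p1 {ι : Type*} [Countable ι] [Nonempty ι]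
    {H : Type*} [NormedAddCommGroup H] [InnerProductSpace ℂ H] [CompleteSpace H]
    (P : Set (MonoidAlgebra ℂ (FreeMonoid ι))) (hP : ∀ p ∈ P, Poisson.IsHomogeneous p) :
    -- a completely positive map is a Poisson transform iff it comes from a row contraction
    (∀ μ : Poisson.cstarGenerated (Poisson.compression P) →ₗ[ℂ] (H →L[ℂ] H),
      Poisson.IsPoissonTransform (Poisson.compression P) μ ↔
        Poisson.IsCompletelyPositive
            (A := Poisson.cstarGenerated (Poisson.compression P)) (A' := H →L[ℂ] H) μ ∧
          ∃ T : ι → H →L[ℂ] H, Poisson.IsRowContraction T ∧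
            (∀ p ∈ P, Poisson.evalPoly T p = 0) ∧
            Poisson.Represents (Poisson.compression P) T μ) ∧
    -- every row contraction that satisfies the relations comes from a Poisson transform
    (∀ T : ι → H →L[ℂ] H, Poisson.IsRowContraction T →
      (∀ p ∈ P, Poisson.evalPoly T p = 0) →
      ∃ μ : Poisson.cstarGenerated (Poisson.compression P) →ₗ[ℂ] (H →L[ℂ] H),
        Poisson.IsPoissonTransform (Poisson.compression P) μ ∧
          Poisson.Represents (Poisson.compression P) T μ) ∧
    -- complete positivity need not be required if the products `B_α B_β^*` span a dense subspace
    (Dense (Submodule.span ℂ (Set.range fun αβ : FreeMonoid ι × FreeMonoid ι =>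
        Poisson.gword (Poisson.compression P) αβ.1 *
          star (Poisson.gword (Poisson.compression P) αβ.2)) :
        Set (Poisson.cstarGenerated (Poisson.compression P))) →
      ∀ μ : Poisson.cstarGenerated (Poisson.compression P) →ₗ[ℂ] (H →L[ℂ] H), Continuous μ →
        (Poisson.IsPoissonTransform (Poisson.compression P) μ ↔
          ∃ T : ι → H →L[ℂ] H, Poisson.IsRowContraction T ∧
            (∀ p ∈ P, Poisson.evalPoly T p = 0) ∧
            Poisson.Represents (Poisson.compression P) T μ)) := by
  have key : ∀ μ : Poisson.cstarGenerated (Poisson.compression P) →ₗ[ℂ] (H →L[ℂ] H),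
      Poisson.IsPoissonTransform (Poisson.compression P) μ →
        ∃ T : ι → H →L[ℂ] H, Poisson.IsRowContraction T ∧
          (∀ p ∈ P, Poisson.evalPoly T p = 0) ∧
          Poisson.Represents (Poisson.compression P) T μ := fun μ hμ =>
    ⟨_, hμ.isRowContraction (Poisson.isRowContraction_compression P),
      fun p hp => hμ.evalPoly_eq_zero (Poisson.evalPoly_compression_eq_zero hp), hμ.represents⟩
  have hex : ∀ T : ι → H →L[ℂ] H, Poisson.IsRowContraction T →
      (∀ p ∈ P, Poisson.evalPoly T p = 0) →
      ∃ μ : Poisson.cstarGenerated (Poisson.compression P) →ₗ[ℂ] (H →L[ℂ] H),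
        Poisson.IsPoissonTransform (Poisson.compression P) μ ∧
          Poisson.Represents (Poisson.compression P) T μ := fun T hT hTP => by
    obtain ⟨μ, hμ, hTμ⟩ := Poisson.exists_representing hP hT hTP
    exact ⟨μ, hTμ.isPoissonTransform hμ.isCompletelyPositive, hTμ⟩
  refine ⟨fun μ => ⟨fun hμ => ⟨hμ.completelyPositive, key μ hμ⟩, ?_⟩, hex,
    fun hdense μ hc => ⟨key μ, ?_⟩⟩
  · rintro ⟨hμ, T, -, -, hTμ⟩
    exact hTμ.isPoissonTransform hμ
  · rintro ⟨T, hT, hTP, hTμ⟩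
    obtain ⟨ν, hν, hTν⟩ := hex T hT hTP
    have hνc : Continuous ν := hν.completelyPositive.continuous
    -- Both maps are continuous and agree on the products `B_α B_β^*`, whose span is dense, so `μ`
    -- inherits complete positivity from `ν`.
    have heq : μ = ν := by
      refine DFunLike.coe_injective (hc.ext_on hdense hνc ?_)
      refine LinearMap.eqOn_span ?_
      rintro _ ⟨⟨α, β⟩, rfl⟩
      exact (hTμ α β).trans (hTν α β).symm
    rw [heq]
    exact hν
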